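/- Let $R$ be a commutative Noetherian ring with identity, $\mathfrak a$ an ideal of $R$ and $M$ a finitely generated $R$-module. Write $H^i_{\mathfrak a}(M)=\varinjlim_n \operatorname{Ext}^i_R(R/\mathfrak a^n,M)$ and let $\operatorname{cd}(\mathfrak a,M)=\sup\{i\ge 0: H^i_{\mathfrak a}(M)\ne 0\}$, with value $-\infty$ if there is no such $i$. Let $\operatorname{ara}(\mathfrak a,M)$ be the least $n\ge 0$ for which there are $x_1,\dots,x_n\in R$ with $$\operatorname{Rad}(\langle x_1,\dots,x_n\rangle+\operatorname{Ann}_RM)=\operatorname{Rad}(\mathfrak a+\operatorname{Ann}_RM).\qquad(*)$$ An $\mathfrak a$-relative system of parameters of $M$ is a sequence $x_1,\dots,x_c\in\mathfrak a$ of length $c=\operatorname{cd}(\mathfrak a,M)$ that satisfies $(*)$ with $n=c$. Let $\operatorname{grade}(\mathfrak a,M)$ be the supremum of the lengths of $M$-regular sequences contained in $\mathfrak a$, where a sequence $x_1,\dots,x_n$ is $M$-regular if $x_i$ is a non-zero-divisor on $M/\langle x_1,\dots,x_{i-1}\rangle M$ for $1\le i\le n$ and $M\neq\langle x_1,\dots,x_n\rangle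 M$. The module $M$ is called $\mathfrak a$-relative Cohen–Macaulay if $M\ne\mathfrak aM$ and $\operatorname{grade}(\mathfrak a,M)=\operatorname{cd}(\mathfrak a,M)$. Suppose that $\operatorname{ara}(\mathfrak a,M)=\operatorname{cd}(\mathfrak a,M)$, and consider the following conditions: (i) $M$ is $\mathfrak a$-relative Cohen–Macaulay; (ii) every $\mathfrak a$-relative system of parameters of $M$ is an $M$-regular sequence; (iii) there exists an $\mathfrak a$-relative system of parameters of $M$ which is an $M$-regular sequence. Then (i) and (iii) are equivalent. If moreover $\mathfrak a$ is contained in the Jacobson radical of $R$, then all three conditions are equivalent. -/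

import Mathlib

universe u

noncomputable section

namespace RelativeCM

variable {R : Type u} [CommRing R]

/-- The cohomological dimension `cd(𝔞, M)`: the supremum of the `i` with `H^i_𝔞(M) ≠ 0`,
where `H^i_𝔞(M) = colim_n Ext^i(R/𝔞^n, M)`. The supremum is taken in `{-∞} ∪ ℕ ∪ {∞}`,
so it is `⊥ = -∞` when all local cohomology modules vanish. -/
def cd (𝔞 : Ideal R) (M : Type u) [AddCommGroup M] [Module R M] : WithBot ℕ∞ :=
  ⨆ (i : ℕ) (_ : Nontrivial ((localCohomology 𝔞 i).obj (ModuleCat.of R M))), (i : WithBot ℕ∞)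

/-- The sequence `xs` satisfies `Rad(⟨xs⟩ + Ann M) = Rad(𝔞 + Ann M)`. -/
def SameRadical (𝔞 : Ideal R) (M : Type u) [AddCommGroup M] [Module R M] (xs : List R) : Prop :=
  (Ideal.ofList xs ⊔ Module.annihilator R M).radical = (𝔞 ⊔ Module.annihilator R M).radical

/-- The arithmetic rank `ara(𝔞, M)` of `𝔞` with respect to `M`: the infimum of the lengths of
the sequences `xs` in `R` with `Rad(⟨xs⟩ + Ann M) = Rad(𝔞 + Ann M)`. -/
def ara (𝔞 : Ideal R) (M : Type u) [AddCommGroup M] [Module R M] : ℕ∞ :=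
  ⨅ (xs : List R) (_ : SameRadical 𝔞 M xs), (xs.length : ℕ∞)

/-- `xs` is an `𝔞`-relative system of parameters of `M`: a sequence of `cd(𝔞, M)` elements of `𝔞`
with `Rad(⟨xs⟩ + Ann M) = Rad(𝔞 + Ann M)`. (No sequence qualifies when `cd(𝔞, M) = -∞`, that is,
when `M = 𝔞 M`.) -/
structure IsRelSOP (𝔞 : Ideal R) (M : Type u) [AddCommGroup M] [Module R M]
    (xs : List R) : Prop where
  mem : ∀ x ∈ xs, x ∈ 𝔞
  length_eq : (xs.length : WithBot ℕ∞) = cd 𝔞 M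
  sameRadical : SameRadical 𝔞 M xs

/-- The grade of `𝔞` on `M`: the supremum of the lengths of the `M`-regular sequences in `𝔞`. -/
def grade (𝔞 : Ideal R) (M : Type u) [AddCommGroup M] [Module R M] : ℕ∞ :=
  ⨆ (xs : List R) (_ : (∀ x ∈ xs, x ∈ 𝔞) ∧ RingTheory.Sequence.IsRegular M xs), (xs.length : ℕ∞)

/-- `M` is `𝔞`-relative Cohen–Macaulay: `M ≠ 𝔞 M` and `grade(𝔞, M) = cd(𝔞, M)`. -/
structure IsRelCM (𝔞 : Ideal R) (M : Type u) [AddCommGroup M] [Module R M] : Prop where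
  ne_smul_top : (⊤ : Submodule R M) ≠ 𝔞 • (⊤ : Submodule R M)
  grade_eq_cd : (grade 𝔞 M : WithBot ℕ∞) = cd 𝔞 M

end RelativeCM

end

/-!
The grade of `𝔞` on `M` is unchanged when `𝔞` is replaced by an ideal `J` contained in it with
the same radical modulo `Ann M`. If `M ≠ 𝔞M`, then `M ≠ JM`, and such a `J` with `c` generators
has grade at most `c`; equality holds precisely when `J` is generated by an `M`-regular sequence of
length `c`. The hypothesis `ara(𝔞, M) = cd(𝔞, M)` says that there is such a `J` with
`c = cd(𝔞, M)` generators, that is, that relative systems of parameters exist. So a regular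
relative system of parameters forces `grade(𝔞, M) = c`, and conversely, if `grade(𝔞, M) = c`, then
the generators of `J` can be changed into a regular sequence. When `𝔞` lies in the Jacobson
radical, no change is needed: any `c` generators of an ideal of grade `c` form a regular sequence.

The lower bound on the grade is handled through `GradeGE`, the existence of a weakly regular
sequence of given length in an ideal. Its basic property is the exchange property
`GradeGE.quotSMulTop`: factoring out any regular element of the ideal costs just one from the
length. From it follow the invariance under radicals (`GradeGE.of_le_radical`) and, by prime
avoidance in the coset of a generator, `exists_isWeaklyRegular_ofList_eq` and the upper bound
`top_eq_ofList_smul_of_gradeGE`. In the Jacobson radical, Nakayama's lemma shows that removing a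
generator lowers the grade by at most one (`GradeGE.of_sup_span_singleton`), which gives
`isWeaklyRegular_of_gradeGE_ofList`.
-/

namespace RelativeCM

open RingTheory.Sequence Pointwise

/-! ### Regular elements -/

section RegularElements

variable {R : Type*} [CommRing R] {M : Type*} [AddCommGroup M] [Module R M]

theorem isSMulRegular_quotSMulTop_iff {x y : R} :
    IsSMulRegular (QuotSMulTop x M) y ↔ ∀ m m' : M, y • m = x • m' → ∃ m'', m = x • m'' := by
  rw [isSMulRegular_quotient_iff_mem_of_smul_mem]
  simp only [Submodule.mem_smul_pointwise_iff_exists, Submodule.mem_top, true_and]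
  exact ⟨fun h m m' e => (h m ⟨m', e.symm⟩).imp fun _ => Eq.symm,
    fun h m ⟨m', e⟩ => (h m m' e.symm).imp fun _ => Eq.symm⟩

/-- Over a Noetherian ring, an ideal that kills no nonzero element of a finitely generated module
contains an element that is regular on it. -/
theorem exists_isSMulRegular_of_forall_smul_eq_zero [IsNoetherianRing R] [Module.Finite R M]
    {I : Ideal R} (h : ∀ m : M, (∀ i ∈ I, i • m = 0) → m = 0) :
    ∃ x ∈ I, IsSMulRegular M x := by
  have : Subsingleton ((R ⧸ I) →ₗ[R] M) := by
    refine subsingleton_of_forall_eq 0 fun f => ?_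
    have h1 : f 1 = 0 := h _ fun i hi => by
      rw [← map_smul, Algebra.smul_def, mul_one, Ideal.Quotient.algebraMap_eq,
        Ideal.Quotient.eq_zero_iff_mem.mpr hi, map_zero]
    ext
    simpa using h1
  simpa [Ideal.annihilator_quotient] using IsSMulRegular.subsingleton_linearMap_iff.mp this

/-- Prime avoidance for a coset: if the ideal generated by `y` and `J` lies in none of finitely
many primes, some element of `y + J` lies in none of them. -/
theorem exists_add_forall_notMem_of_isPrime {y : R} {J : Ideal R} (s : Finset (Ideal R))
    (hs : ∀ p ∈ s, p.IsPrime) (h : ∀ p ∈ s, ¬ (y ∈ p ∧ J ≤ p)) :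
    ∃ j ∈ J, ∀ p ∈ s, y + j ∉ p := by
  classical
  induction s using Finset.strongInduction with
  | H s ih =>
    rcases s.eq_empty_or_nonempty with rfl | hne
    · exact ⟨0, J.zero_mem, by simp⟩
    -- a minimal member `p` contains no other member, which gives room to move the coset
    -- representative off `p` without disturbing the others
    obtain ⟨p, hp⟩ := s.exists_minimal hne
    obtain ⟨j, hj, hjs⟩ := ih (s.erase p) (Finset.erase_ssubset hp.prop)
      (fun q hq => hs q (Finset.mem_of_mem_erase hq))
      (fun q hq => h q (Finset.mem_of_mem_erase hq))
    have hpp := hs p hp.prop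
    by_cases hjp : y + j ∈ p
    · have hJ : ¬ J ≤ p := fun hle => h p hp.prop ⟨(p.add_mem_iff_left (hle hj)).mp hjp, hle⟩
      have hinf : ¬ J ⊓ (s.erase p).inf id ≤ p := by
        intro hle
        rcases hpp.inf_le.mp hle with hle | hle
        · exact hJ hle
        · obtain ⟨q, hq, hqp⟩ := hpp.inf_le'.mp hle
          exact Finset.ne_of_mem_erase hq
            (le_antisymm hqp (hp.le_of_le (Finset.mem_of_mem_erase hq) hqp))
      obtain ⟨t, ht, htp⟩ := SetLike.not_le_iff_exists.mp hinf
      refine ⟨j + t, J.add_mem hj ht.1, fun q hq => ?_⟩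
      rw [← add_assoc]
      by_cases hqp : q = p
      · subst hqp
        exact fun hmem => htp ((q.add_mem_iff_right hjp).mp hmem)
      · have hq' := Finset.mem_erase.mpr ⟨hqp, hq⟩
        have htq : t ∈ q := (Finset.inf_le hq' : (s.erase p).inf id ≤ q) ht.2
        exact fun hmem => hjs q hq' ((q.add_mem_iff_left htq).mp hmem)
    · refine ⟨j, hj, fun q hq => ?_⟩
      by_cases hqp : q = p
      · exact hqp ▸ hjp
      · exact hjs q (Finset.mem_erase.mpr ⟨hqp, hq⟩)

/-- If the ideal generated by `y` and `J` contains an `M`-regular element, so does the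
coset `y + J`. -/
theorem exists_add_isSMulRegular [IsNoetherianRing R] [Module.Finite R M] {y x : R} {J : Ideal R}
    (hx : x ∈ Ideal.span {y} ⊔ J) (hreg : IsSMulRegular M x) :
    ∃ j ∈ J, IsSMulRegular M (y + j) := by
  have hU := biUnion_associatedPrimes_eq_compl_regular R M
  have hfin := associatedPrimes.finite R M
  obtain ⟨j, hj, hjp⟩ := exists_add_forall_notMem_of_isPrime (y := y) (J := J) hfin.toFinset
    (fun p hp => (hfin.mem_toFinset.mp hp).isPrime) fun p hp ⟨hy, hJ⟩ => by
      have hxp : x ∈ p :=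
        sup_le ((Ideal.span_singleton_le_iff_mem p).mpr hy) hJ hx
      have : x ∈ ⋃ p ∈ associatedPrimes R M, (p : Set R) :=
        Set.mem_biUnion (hfin.mem_toFinset.mp hp) hxp
      rw [hU] at this
      exact this hreg
  refine ⟨j, hj, by_contra fun hn => ?_⟩
  have : y + j ∈ ⋃ p ∈ associatedPrimes R M, (p : Set R) := by
    rw [hU]; exact hn
  obtain ⟨p, hp, hmem⟩ := Set.mem_iUnion₂.mp this
  exact hjp p (hfin.mem_toFinset.mpr hp) hmem

/-- If `a` is regular on `M` and `b` on `M / aM`, then `a` is regular on `M / bM`. For `b, a` to be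
weakly regular it is thus only missing that `b` is regular on `M`. -/
theorem isSMulRegular_quotSMulTop_swap {a b : R} (ha : IsSMulRegular M a)
    (hab : IsSMulRegular (QuotSMulTop a M) b) :
    IsSMulRegular (QuotSMulTop b M) a := by
  rw [isSMulRegular_quotSMulTop_iff] at hab ⊢
  intro m m' e
  obtain ⟨m'', rfl⟩ := hab m' m e.symm
  exact ⟨m'', ha (show a • m = a • b • m'' by rw [e, smul_comm])⟩

variable (M) in
/-- `M / (a, b)M` does not depend on the order in which `a` and `b` are factored out. -/
def quotSMulTopComm (a b : R) :
    QuotSMulTop b (QuotSMulTop a M) ≃ₗ[R] QuotSMulTop a (QuotSMulTop b M) :=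
  (Submodule.quotEquivOfEq _ _ (by simp [Submodule.ideal_span_singleton_smul])).trans <|
  (Submodule.quotOfListConsSMulTopEquivQuotSMulTopInner M a [b]).symm.trans <|
  (Submodule.quotEquivOfEq _ _ (by simp [sup_comm])).trans <|
  (Submodule.quotOfListConsSMulTopEquivQuotSMulTopInner M b [a]).trans <|
  Submodule.quotEquivOfEq _ _ (by simp [Submodule.ideal_span_singleton_smul])

end RegularElements

/-! ### Lower bounds for the grade -/

section GradeGE

variable {R : Type*} [CommRing R] {M : Type*} [AddCommGroup M] [Module R M]

/-- `I` contains a weakly `M`-regular sequence of length `n`. The condition `M ≠ IM` is left out,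
so that the property passes to quotients without side conditions; for `M = IM` it carries no
information on the grade. -/
def GradeGE (I : Ideal R) (n : ℕ) (M : Type*) [AddCommGroup M] [Module R M] : Prop :=
  ∃ rs : List R, rs.length = n ∧ (∀ r ∈ rs, r ∈ I) ∧ IsWeaklyRegular M rs

theorem gradeGE_zero (I : Ideal R) : GradeGE I 0 M :=
  ⟨[], by simp⟩

theorem gradeGE_succ_iff {I : Ideal R} {n : ℕ} :
    GradeGE I (n + 1) M ↔ ∃ x ∈ I, IsSMulRegular M x ∧ GradeGE I n (QuotSMulTop x M) := by
  constructor
  · rintro ⟨_ | ⟨x, rs⟩, hl, hI, h⟩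
    · simp at hl
    · rw [isWeaklyRegular_cons_iff] at h
      exact ⟨x, hI x (by simp), h.1, rs, by simpa using hl, fun r hr => hI r (by simp [hr]), h.2⟩
  · rintro ⟨x, hx, hreg, rs, hl, hI, h⟩
    exact ⟨x :: rs, by simp [hl], by simpa [hx] using hI, h.cons hreg⟩

theorem GradeGE.of_le {I : Ideal R} {m n : ℕ} (h : GradeGE I n M) (hmn : m ≤ n) :
    GradeGE I m M := by
  obtain ⟨rs, hl, hI, h⟩ := h
  refine ⟨rs.take m, by simp [hl, hmn], fun r hr => hI r (List.mem_of_mem_take hr), ?_⟩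
  rw [← List.take_append_drop m rs, isWeaklyRegular_append_iff] at h
  exact h.1

theorem GradeGE.congr {M' : Type*} [AddCommGroup M'] [Module R M'] {I : Ideal R} {n : ℕ}
    (e : M ≃ₗ[R] M') (h : GradeGE I n M) : GradeGE I n M' := by
  obtain ⟨rs, hl, hI, h⟩ := h
  exact ⟨rs, hl, hI, (e.isWeaklyRegular_congr rs).mp h⟩

theorem GradeGE.exists_isSMulRegular {I : Ideal R} {n : ℕ} (h : GradeGE I (n + 1) M) :
    ∃ x ∈ I, IsSMulRegular M x :=
  let ⟨x, hx, hreg, _⟩ := gradeGE_succ_iff.mp h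
  ⟨x, hx, hreg⟩

theorem eq_zero_of_isSMulRegular {I : Ideal R} {x : R} (hx : x ∈ I) (hreg : IsSMulRegular M x)
    {m : M} (hm : ∀ i ∈ I, i • m = 0) : m = 0 :=
  hreg.right_eq_zero_of_smul (hm x hx)

variable [IsNoetherianRing R] [Module.Finite R M]

/-- The case of a sequence of length two in the exchange property `GradeGE.quotSMulTop`. -/
theorem exists_isSMulRegular_quotSMulTop {I : Ideal R} {x y z : R}
    (hxM : IsSMulRegular M x) (hy : y ∈ I) (hyM : IsSMulRegular M y)
    (hz : z ∈ I) (hzM : IsSMulRegular (QuotSMulTop y M) z) :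
    ∃ w ∈ I, IsSMulRegular (QuotSMulTop x M) w := by
  refine exists_isSMulRegular_of_forall_smul_eq_zero fun m hm => ?_
  obtain ⟨m, rfl⟩ := Submodule.Quotient.mk_surjective _ m
  have key : ∀ i ∈ I, ∃ m', i • m = x • m' := fun i hi => by
    have := hm i hi
    rw [← Submodule.Quotient.mk_smul, Submodule.Quotient.mk_eq_zero,
      Submodule.mem_smul_pointwise_iff_exists] at this
    obtain ⟨m', -, e⟩ := this
    exact ⟨m', e.symm⟩
  obtain ⟨m', hm'⟩ := key y hy
  obtain ⟨m₁, hm₁⟩ := key z hz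
  rw [isSMulRegular_quotSMulTop_iff] at hzM
  obtain ⟨m₂, rfl⟩ := hzM m' m₁ <| hxM <| by
    simp only
    rw [smul_comm x z, ← hm', smul_comm x y, ← hm₁, smul_comm]
  rw [Submodule.Quotient.mk_eq_zero, Submodule.mem_smul_pointwise_iff_exists]
  exact ⟨m₂, trivial, (hyM (show y • m = y • x • m₂ by rw [hm', smul_comm])).symm⟩

/-- The exchange property behind the invariance of the length of maximal regular sequences: any
regular element of `I` can serve as the first member of a weakly regular sequence in `I` of
given length. -/
theorem GradeGE.quotSMulTop {I : Ideal R} {n : ℕ} {x : R} (h : GradeGE I (n + 1) M)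
    (hx : x ∈ I) (hreg : IsSMulRegular M x) : GradeGE I n (QuotSMulTop x M) := by
  induction n generalizing M x with
  | zero => exact gradeGE_zero I
  | succ n ih =>
    obtain ⟨y, hy, hyM, hyn⟩ := gradeGE_succ_iff.mp h
    obtain ⟨z₁, hz₁, hz₁y⟩ := hyn.exists_isSMulRegular
    obtain ⟨z₂, hz₂, hz₂x⟩ := exists_isSMulRegular_quotSMulTop hreg hy hyM hz₁ hz₁y
    -- an element regular on `M`, `M / xM` and `M / yM` at once mediates between `x` and `y`
    obtain ⟨z, hz, hzr⟩ : ∃ z ∈ I,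
        IsSMulRegular (M × QuotSMulTop x M × QuotSMulTop y M) z := by
      refine exists_isSMulRegular_of_forall_smul_eq_zero fun m hm => ?_
      simp only [Prod.ext_iff, Prod.smul_fst, Prod.smul_snd, Prod.fst_zero, Prod.snd_zero] at hm ⊢
      exact ⟨eq_zero_of_isSMulRegular hx hreg fun i hi => (hm i hi).1,
        eq_zero_of_isSMulRegular hz₂ hz₂x fun i hi => (hm i hi).2.1,
        eq_zero_of_isSMulRegular hz₁ hz₁y fun i hi => (hm i hi).2.2⟩
    have hzM : IsSMulRegular M z := fun a b e =>
      congrArg Prod.fst (@hzr (a, 0, 0) (b, 0, 0) (by simpa [Prod.ext_iff] using e))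
    have hzx : IsSMulRegular (QuotSMulTop x M) z := fun a b e =>
      congrArg (fun t => t.2.1) (@hzr (0, a, 0) (0, b, 0) (by simpa [Prod.ext_iff] using e))
    have hzy : IsSMulRegular (QuotSMulTop y M) z := fun a b e =>
      congrArg (fun t => t.2.2) (@hzr (0, 0, a) (0, 0, b) (by simpa [Prod.ext_iff] using e))
    have hMz : GradeGE I (n + 1) (QuotSMulTop z M) := gradeGE_succ_iff.mpr
      ⟨y, hy, isSMulRegular_quotSMulTop_swap hyM hzy,
        (ih hyn hz hzy).congr (quotSMulTopComm M y z)⟩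
    exact gradeGE_succ_iff.mpr ⟨z, hz, hzx,
      (ih hMz hx (isSMulRegular_quotSMulTop_swap hreg hzx)).congr (quotSMulTopComm M z x)⟩

/-- The grade depends on the ideal only up to radical and modulo the annihilator of the module. -/
theorem GradeGE.of_le_radical {I J : Ideal R} {n : ℕ} (h : GradeGE I n M) (hJI : J ≤ I)
    (hI : I ≤ (J ⊔ Module.annihilator R M).radical) : GradeGE J n M := by
  induction n generalizing M with
  | zero => exact gradeGE_zero J
  | succ n ih =>
    obtain ⟨x, hx, hreg⟩ := h.exists_isSMulRegular
    obtain ⟨k, hk⟩ := hI hx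
    obtain ⟨j, hj, t, ht, hjt⟩ := Submodule.mem_sup.mp hk
    have hj' : IsSMulRegular M j := by
      have hpow := hreg.pow k
      rw [← hjt] at hpow
      intro a b e
      refine hpow ?_
      simp only [add_smul, Module.mem_annihilator.mp ht, add_zero]
      exact e
    refine gradeGE_succ_iff.mpr ⟨j, hj, hj', ih (h.quotSMulTop (hJI hj) hj') ?_⟩
    refine hI.trans (Ideal.radical_mono (sup_le_sup_left ?_ J))
    exact LinearMap.annihilator_le_of_surjective _ (Submodule.mkQ_surjective _)

end GradeGE

/-! ### Ideals generated by as many elements as their grade -/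

section Generators

variable {R : Type*} [CommRing R]

theorem span_singleton_add_sup {x j : R} {J : Ideal R} (hj : j ∈ J) :
    Ideal.span {x + j} ⊔ J = Ideal.span {x} ⊔ J := by
  refine le_antisymm (sup_le ?_ le_sup_right) (sup_le ?_ le_sup_right) <;>
    rw [Ideal.span_singleton_le_iff_mem]
  · exact Ideal.add_mem _ (Ideal.mem_sup_left (Ideal.mem_span_singleton_self x))
      (Ideal.mem_sup_right hj)
  · have := Ideal.sub_mem _ (Ideal.mem_sup_left (Ideal.mem_span_singleton_self (x + j)))
      (Ideal.mem_sup_right hj : j ∈ Ideal.span {x + j} ⊔ J)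
    rwa [add_sub_cancel_right] at this

theorem mem_ofList {x : R} {xs : List R} (hx : x ∈ xs) : x ∈ Ideal.ofList xs :=
  Ideal.subset_span hx

theorem ofList_le {xs : List R} {I : Ideal R} (h : ∀ x ∈ xs, x ∈ I) : Ideal.ofList xs ≤ I :=
  Ideal.span_le.mpr h

variable {M : Type*} [AddCommGroup M] [Module R M]

theorem mem_annihilator_quotSMulTop (x : R) : x ∈ Module.annihilator R (QuotSMulTop x M) := by
  rw [Module.mem_annihilator]
  intro m
  obtain ⟨m, rfl⟩ := Submodule.Quotient.mk_surjective _ m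
  rw [← Submodule.Quotient.mk_smul, Submodule.Quotient.mk_eq_zero]
  exact Submodule.smul_mem_pointwise_smul m x ⊤ trivial

variable [IsNoetherianRing R] [Module.Finite R M]

/-- A generator can be modified by the others so as to become regular; factoring it out removes
one generator and lowers the grade by one. -/
theorem GradeGE.exists_add_ofList {x : R} {xs : List R} {n : ℕ}
    (h : GradeGE (Ideal.ofList (x :: xs)) (n + 1) M) :
    ∃ j ∈ Ideal.ofList xs, IsSMulRegular M (x + j) ∧
      GradeGE (Ideal.ofList xs) n (QuotSMulTop (x + j) M) := by
  rw [Ideal.ofList_cons] at h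
  obtain ⟨u, hu, hureg⟩ := h.exists_isSMulRegular
  obtain ⟨j, hj, hreg⟩ := exists_add_isSMulRegular hu hureg
  have hle := span_singleton_add_sup (x := x) hj
  refine ⟨j, hj, hreg, (h.quotSMulTop ?_ hreg).of_le_radical le_sup_right ?_⟩
  · rw [← hle]
    exact Ideal.mem_sup_left (Ideal.mem_span_singleton_self _)
  · rw [← hle, sup_comm]
    exact (sup_le_sup_left ((Ideal.span_singleton_le_iff_mem _).mpr
      (mem_annihilator_quotSMulTop (x + j))) _).trans Ideal.le_radical

/-- An ideal with `n` generators that contains a weakly regular sequence of length `n` is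
generated by such a sequence. -/
theorem exists_isWeaklyRegular_ofList_eq {xs : List R}
    (h : GradeGE (Ideal.ofList xs) xs.length M) :
    ∃ ys : List R, ys.length = xs.length ∧ Ideal.ofList ys = Ideal.ofList xs ∧
      IsWeaklyRegular M ys := by
  induction xs generalizing M with
  | nil => exact ⟨[], rfl, rfl, .nil R M⟩
  | cons x xs ih =>
    obtain ⟨j, hj, hreg, hn⟩ := GradeGE.exists_add_ofList h
    obtain ⟨ys, hl, he, hys⟩ := ih hn
    refine ⟨(x + j) :: ys, by simp [hl], ?_, hys.cons hreg⟩
    rw [Ideal.ofList_cons, Ideal.ofList_cons, he, span_singleton_add_sup hj]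

/-- The grade of a proper ideal is at most its number of generators: an ideal `I` with `n`
generators contains a weakly `M`-regular sequence of length `n + 1` only if `M = IM`. -/
theorem top_eq_ofList_smul_of_gradeGE {xs : List R}
    (h : GradeGE (Ideal.ofList xs) (xs.length + 1) M) :
    (⊤ : Submodule R M) = Ideal.ofList xs • ⊤ := by
  induction xs generalizing M with
  | nil =>
    obtain ⟨x, hx, hreg⟩ := h.exists_isSMulRegular
    rw [Ideal.ofList_nil, Ideal.mem_bot] at hx
    subst hx
    have := hreg.subsingleton
    exact Subsingleton.elim _ _
  | cons x xs ih =>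
    obtain ⟨j, hj, -, hn⟩ := GradeGE.exists_add_ofList h
    have := (Submodule.top_eq_ofList_cons_smul_iff (x + j) xs).mpr (ih hn)
    rwa [Ideal.ofList_cons, span_singleton_add_sup hj, ← Ideal.ofList_cons] at this

end Generators

/-! ### Generators in the Jacobson radical -/

section Jacobson

variable {R : Type*} [CommRing R] [IsNoetherianRing R]
variable {M : Type*} [AddCommGroup M] [Module R M] [Module.Finite R M]

/-- Adjoining one element `x` of the Jacobson radical to an ideal that consists of zero-divisors
on `M` gives an ideal of grade at most one. -/
theorem GradeGE.exists_isSMulRegular_of_mem_jacobson {I : Ideal R} {x : R}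
    (hx : x ∈ (⊥ : Ideal R).jacobson) (h : GradeGE (I ⊔ Ideal.span {x}) 2 M) :
    ∃ u ∈ I, IsSMulRegular M u := by
  obtain ⟨y, hy, hyM, h1⟩ := gradeGE_succ_iff.mp h
  obtain ⟨z, hz, hzy⟩ := h1.exists_isSMulRegular
  obtain ⟨i, hi, t, ht, rfl⟩ := Submodule.mem_sup.mp hy
  obtain ⟨r, rfl⟩ := Ideal.mem_span_singleton'.mp ht
  obtain ⟨i', hi', t, ht, rfl⟩ := Submodule.mem_sup.mp hz
  obtain ⟨s, rfl⟩ := Ideal.mem_span_singleton'.mp ht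
  rw [isSMulRegular_quotSMulTop_iff] at hzy
  -- by Nakayama it suffices that the submodule `K` of elements killed by `I` satisfies `K = xK`
  set K : Submodule R M := Submodule.torsionBySet R M I with hK
  have mem_K : ∀ {m : M}, m ∈ K ↔ ∀ a ∈ I, a • m = 0 := by
    simp [hK, Submodule.mem_torsionBySet_iff]
  have hKx : K ≤ Ideal.span {x} • K := by
    intro k hk
    -- on `K` the regular sequence acts as `r * x, s * x`, hence `r • k` is divisible by the
    -- first member, and the quotient `m` lies in `K` again
    obtain ⟨m, hm⟩ := hzy (r • k) (s • k) <| by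
      simp only [add_smul, mul_smul, smul_comm i', smul_comm i, mem_K.mp hk i hi,
        mem_K.mp hk i' hi', smul_zero, zero_add]
      rw [smul_comm x r, smul_comm s r, smul_comm x s]
    have hmK : m ∈ K := mem_K.mpr fun a ha => hyM.right_eq_zero_of_smul <| by
      rw [smul_comm, ← hm, smul_comm, mem_K.mp hk a ha, smul_zero]
    have hkm : k = x • m := by
      have hd : k - x • m ∈ K := K.sub_mem hk (K.smul_mem x hmK)
      refine sub_eq_zero.mp (hyM.right_eq_zero_of_smul ?_)
      rw [add_smul, mem_K.mp hmK i hi, zero_add, mul_smul] at hm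
      rw [add_smul, mem_K.mp hd i hi, zero_add, mul_comm, mul_smul, smul_sub, hm, sub_self,
        smul_zero]
    rw [hkm]
    exact Submodule.smul_mem_smul (Ideal.mem_span_singleton_self x) hmK
  have hbot : K = ⊥ := Submodule.eq_bot_of_le_smul_of_le_jacobson_bot _ _
    (IsNoetherian.noetherian K) hKx ((Ideal.span_singleton_le_iff_mem _).mpr hx)
  refine exists_isSMulRegular_of_forall_smul_eq_zero fun m hm => ?_
  have := mem_K.mpr hm
  rwa [hbot, Submodule.mem_bot] at this

/-- Removing a generator that lies in the Jacobson radical lowers the grade by at most one. -/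
theorem GradeGE.of_sup_span_singleton {I : Ideal R} {n : ℕ} {x : R}
    (hx : x ∈ (⊥ : Ideal R).jacobson) (h : GradeGE (I ⊔ Ideal.span {x}) (n + 1) M) :
    GradeGE I n M := by
  induction n generalizing M with
  | zero => exact gradeGE_zero I
  | succ n ih =>
    obtain ⟨u, hu, hreg⟩ := (h.of_le (by omega)).exists_isSMulRegular_of_mem_jacobson hx
    exact gradeGE_succ_iff.mpr ⟨u, hu, hreg, ih (h.quotSMulTop (Ideal.mem_sup_left hu) hreg)⟩

theorem GradeGE.of_sup_ofList {I : Ideal R} {n : ℕ} {xs : List R}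
    (hxs : ∀ x ∈ xs, x ∈ (⊥ : Ideal R).jacobson)
    (h : GradeGE (I ⊔ Ideal.ofList xs) (n + xs.length) M) : GradeGE I n M := by
  induction xs generalizing I n with
  | nil => simpa using h
  | cons x xs ih =>
    rw [Ideal.ofList_cons, ← sup_assoc] at h
    refine GradeGE.of_sup_span_singleton (hxs x (by simp))
      (ih (fun y hy => hxs y (by simp [hy])) (h.of_le ?_))
    rw [List.length_cons]
    omega

/-- If an ideal in the Jacobson radical contains a weakly regular sequence of length `n`, then any
`n` generators of it, in any order, form a weakly regular sequence. -/
theorem isWeaklyRegular_of_gradeGE_ofList {xs : List R}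
    (hxs : ∀ x ∈ xs, x ∈ (⊥ : Ideal R).jacobson) (h : GradeGE (Ideal.ofList xs) xs.length M) :
    IsWeaklyRegular M xs := by
  induction xs generalizing M with
  | nil => exact .nil R M
  | cons x xs ih =>
    have hxs' : ∀ y ∈ xs, y ∈ (⊥ : Ideal R).jacobson := fun y hy => hxs y (by simp [hy])
    have hx : IsSMulRegular M x := by
      -- dropping the other generators leaves a regular element in the ideal generated by `x`
      have h1 : GradeGE (Ideal.span {x}) 1 M := by
        refine GradeGE.of_sup_ofList hxs' ?_
        rwa [← Ideal.ofList_cons, add_comm, ← List.length_cons (a := x)]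
      obtain ⟨u, hu, hreg⟩ := h1.exists_isSMulRegular
      obtain ⟨r, rfl⟩ := Ideal.mem_span_singleton'.mp hu
      exact hreg.of_mul
    refine IsWeaklyRegular.cons hx (ih hxs' ?_)
    refine (h.quotSMulTop (mem_ofList (by simp)) hx).of_le_radical
      (by rw [Ideal.ofList_cons]; exact le_sup_right) ?_
    rw [Ideal.ofList_cons, sup_comm]
    exact (sup_le_sup_left ((Ideal.span_singleton_le_iff_mem _).mpr
      (mem_annihilator_quotSMulTop x)) _).trans Ideal.le_radical

end Jacobson

/-! ### Grade and relative systems of parameters -/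

section RelSOP

variable {R : Type u} [CommRing R] {M : Type u} [AddCommGroup M] [Module R M] {𝔞 : Ideal R}

theorem gradeGE_of_le_grade {n : ℕ} (h : (n : ℕ∞) ≤ grade 𝔞 M) : GradeGE 𝔞 n M := by
  cases n with
  | zero => exact gradeGE_zero 𝔞
  | succ n =>
    -- a supremum of lengths exceeds `n` only if one of the lengths does
    have hlt : (n : ℕ∞) < grade 𝔞 M := lt_of_lt_of_le (by exact_mod_cast n.lt_succ_self) h
    simp only [grade, lt_iSup_iff] at hlt
    obtain ⟨xs, ⟨hmem, hreg⟩, hlen⟩ := hlt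
    exact GradeGE.of_le ⟨xs, rfl, hmem, hreg.toIsWeaklyRegular⟩ (by exact_mod_cast hlen)

theorem top_eq_smul_top_iff [Module.Finite R M] {I : Ideal R} :
    (⊤ : Submodule R M) = I • ⊤ ↔ I ⊔ Module.annihilator R M = ⊤ := by
  constructor
  · intro h
    obtain ⟨r, hr, hrM⟩ := Submodule.exists_sub_one_mem_and_smul_eq_zero_of_fg_of_le_smul I
      (⊤ : Submodule R M) Module.Finite.fg_top h.le
    rw [Ideal.eq_top_iff_one, ← sub_sub_cancel r 1]
    exact Ideal.sub_mem _
      (Ideal.mem_sup_right (Module.mem_annihilator.mpr fun m => hrM m trivial))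
      (Ideal.mem_sup_left hr)
  · intro h
    refine le_antisymm (fun m _ => ?_) le_top
    obtain ⟨i, hi, t, ht, hit⟩ := Submodule.mem_sup.mp ((Ideal.eq_top_iff_one _).mp h)
    rw [← one_smul R m, ← hit, add_smul, Module.mem_annihilator.mp ht, add_zero]
    exact Submodule.smul_mem_smul hi trivial

theorem SameRadical.top_eq_smul_top_iff [Module.Finite R M] {xs : List R}
    (h : SameRadical 𝔞 M xs) :
    (⊤ : Submodule R M) = Ideal.ofList xs • ⊤ ↔ (⊤ : Submodule R M) = 𝔞 • ⊤ := by
  rw [RelativeCM.top_eq_smul_top_iff, RelativeCM.top_eq_smul_top_iff, ← Ideal.radical_eq_top,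
    h, Ideal.radical_eq_top]

theorem SameRadical.le_radical {xs : List R} (h : SameRadical 𝔞 M xs) :
    𝔞 ≤ (Ideal.ofList xs ⊔ Module.annihilator R M).radical := by
  rw [h]
  exact le_sup_left.trans Ideal.le_radical

/-- Elements that generate `𝔞` up to radical and modulo the annihilator can be chosen in `𝔞`: a
power of each lies in `𝔞 + Ann M`, and its component in `𝔞` can take its place. -/
theorem SameRadical.exists_mem {xs : List R} (h : SameRadical 𝔞 M xs) :
    ∃ ys : List R, (∀ y ∈ ys, y ∈ 𝔞) ∧ ys.length = xs.length ∧ SameRadical 𝔞 M ys := by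
  have key : ∀ x ∈ xs, ∃ y ∈ 𝔞, ∃ k : ℕ, ∃ t ∈ Module.annihilator R M, y + t = x ^ k := by
    intro x hx
    have hxr : x ∈ (𝔞 ⊔ Module.annihilator R M).radical := by
      rw [← h]
      exact Ideal.le_radical (Ideal.mem_sup_left (mem_ofList hx))
    obtain ⟨k, hk⟩ := hxr
    obtain ⟨y, hy, t, ht, e⟩ := Submodule.mem_sup.mp hk
    exact ⟨y, hy, k, t, ht, e⟩
  choose! f hf k t ht e using key
  have hmem : ∀ y ∈ xs.map f, y ∈ 𝔞 := by
    simpa using hf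
  refine ⟨xs.map f, hmem, by simp, le_antisymm ?_ ?_⟩
  · exact Ideal.radical_mono (sup_le_sup_right (ofList_le hmem) _)
  · rw [← h, Ideal.radical_le_radical_iff]
    refine sup_le (ofList_le fun x hx => ⟨k x, ?_⟩) (le_sup_right.trans Ideal.le_radical)
    rw [← e x hx]
    exact Ideal.add_mem _ (Ideal.mem_sup_left (mem_ofList (List.mem_map_of_mem hx)))
      (Ideal.mem_sup_right (ht x hx))

theorem exists_sameRadical_length_eq_ara [IsNoetherianRing R] :
    ∃ xs : List R, SameRadical 𝔞 M xs ∧ (xs.length : ℕ∞) = ara 𝔞 M := by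
  obtain ⟨s, hs⟩ := IsNoetherian.noetherian 𝔞
  have hgen : SameRadical 𝔞 M s.toList := by
    have : Ideal.ofList s.toList = 𝔞 := by
      rw [← hs]
      simp [Ideal.ofList]
    rw [SameRadical, this]
  have hne : ara 𝔞 M ≠ ⊤ :=
    ((iInf₂_le s.toList hgen).trans_lt (ENat.natCast_lt_top _)).ne
  have hlt : ara 𝔞 M < ara 𝔞 M + 1 := ENat.lt_add_one_iff hne |>.mpr le_rfl
  conv_lhs at hlt => rw [ara]
  simp only [iInf_lt_iff] at hlt
  obtain ⟨xs, hxs, hl⟩ := hlt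
  exact ⟨xs, hxs, le_antisymm ((ENat.lt_add_one_iff hne).mp hl) (iInf₂_le xs hxs)⟩

theorem exists_isRelSOP [IsNoetherianRing R] (h : (ara 𝔞 M : WithBot ℕ∞) = cd 𝔞 M) :
    ∃ xs : List R, IsRelSOP 𝔞 M xs := by
  obtain ⟨xs, hxs, hl⟩ := exists_sameRadical_length_eq_ara (𝔞 := 𝔞) (M := M)
  obtain ⟨ys, hmem, hlen, hys⟩ := hxs.exists_mem
  exact ⟨ys, hmem, by rw [← h, ← hl, hlen]; rfl, hys⟩

variable [IsNoetherianRing R] [Module.Finite R M]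

/-- A regular relative system of parameters bounds the grade from both sides by its length. -/
theorem IsRelSOP.isRelCM {xs : List R} (hxs : IsRelSOP 𝔞 M xs) (hreg : IsRegular M xs) :
    IsRelCM 𝔞 M := by
  refine ⟨fun h => hreg.top_ne_smul (hxs.sameRadical.top_eq_smul_top_iff.mpr h), ?_⟩
  have hgrade : grade 𝔞 M = (xs.length : ℕ∞) := by
    refine le_antisymm (not_lt.mp fun hlt => ?_) (le_iSup₂_of_le xs ⟨hxs.mem, hreg⟩ le_rfl)
    refine hreg.top_ne_smul (top_eq_ofList_smul_of_gradeGE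
      ((gradeGE_of_le_grade ?_).of_le_radical (ofList_le hxs.mem) hxs.sameRadical.le_radical))
    exact_mod_cast Order.add_one_le_of_lt hlt
  rw [hgrade, ← hxs.length_eq]
  rfl

theorem IsRelCM.gradeGE_ofList {xs : List R} (hM : IsRelCM 𝔞 M) (hxs : IsRelSOP 𝔞 M xs) :
    GradeGE (Ideal.ofList xs) xs.length M := by
  refine (gradeGE_of_le_grade (le_of_eq ?_)).of_le_radical (ofList_le hxs.mem)
    hxs.sameRadical.le_radical
  have := hxs.length_eq.trans hM.grade_eq_cd.symm
  exact WithBot.coe_injective this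

/-- A relative system of parameters of a relative Cohen–Macaulay module can be replaced by a
regular one that generates the same ideal. -/
theorem IsRelCM.exists_isRelSOP_isRegular {xs : List R} (hM : IsRelCM 𝔞 M)
    (hxs : IsRelSOP 𝔞 M xs) : ∃ ys : List R, IsRelSOP 𝔞 M ys ∧ IsRegular M ys := by
  obtain ⟨ys, hl, he, hys⟩ := exists_isWeaklyRegular_ofList_eq (hM.gradeGE_ofList hxs)
  have hrad : SameRadical 𝔞 M ys := by
    rw [SameRadical, he]
    exact hxs.sameRadical
  exact ⟨ys, ⟨fun y hy => ofList_le hxs.mem (he ▸ mem_ofList hy), by rw [hl, hxs.length_eq], hrad⟩,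
    hys, fun h => hM.ne_smul_top (hrad.top_eq_smul_top_iff.mp h)⟩

theorem IsRelCM.isRegular_of_le_jacobson {xs : List R} (hM : IsRelCM 𝔞 M)
    (h𝔞 : 𝔞 ≤ (⊥ : Ideal R).jacobson) (hxs : IsRelSOP 𝔞 M xs) : IsRegular M xs :=
  ⟨isWeaklyRegular_of_gradeGE_ofList (fun x hx => h𝔞 (hxs.mem x hx)) (hM.gradeGE_ofList hxs),
    fun h => hM.ne_smul_top (hxs.sameRadical.top_eq_smul_top_iff.mp h)⟩

end RelSOP

end RelativeCM

theorem theorem3p2 {R : Type u} [CommRing R] [IsNoetherianRing R]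
    {M : Type u} [AddCommGroup M] [Module R M] [Module.Finite R M]
    (𝔞 : Ideal R) (h : (RelativeCM.ara 𝔞 M : WithBot ℕ∞) = RelativeCM.cd 𝔞 M) :
    (RelativeCM.IsRelCM 𝔞 M ↔
      ∃ xs : List R, RelativeCM.IsRelSOP 𝔞 M xs ∧ RingTheory.Sequence.IsRegular M xs) ∧
    (𝔞 ≤ (⊥ : Ideal R).jacobson →
      [RelativeCM.IsRelCM 𝔞 M,
       ∀ xs : List R, RelativeCM.IsRelSOP 𝔞 M xs → RingTheory.Sequence.IsRegular M xs,
       ∃ xs : List R, RelativeCM.IsRelSOP 𝔞 M xs ∧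
         RingTheory.Sequence.IsRegular M xs].TFAE) := by
  obtain ⟨xs, hxs⟩ := RelativeCM.exists_isRelSOP h
  have hiff : RelativeCM.IsRelCM 𝔞 M ↔
      ∃ ys : List R, RelativeCM.IsRelSOP 𝔞 M ys ∧ RingTheory.Sequence.IsRegular M ys :=
    ⟨fun hM => hM.exists_isRelSOP_isRegular hxs, fun ⟨_, hys, hreg⟩ => hys.isRelCM hreg⟩
  refine ⟨hiff, fun h𝔞 => ?_⟩
  tfae_have 1 → 2 := fun hM _ hys => hM.isRegular_of_le_jacobson h𝔞 hys
  tfae_have 2 → 3 := fun hreg => ⟨xs, hxs, hreg xs hxs⟩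
  tfae_have 3 → 1 := hiff.mpr
  tfae_finish
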